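/- Let $M$ be a Peano continuum, i.e. a compact, connected, locally connected, metrizable (nonempty) space, and suppose that $M$ has no cut points, i.e. $M\setminus\{x\}$ is connected for every $x\in M$. A set $S\subset M$ separates two points $a,b\in M\setminus S$ if $a$ and $b$ lie in different components of $M\setminus S$. A cut pair is a set $\{x,y\}$ of two distinct points of $M$, neither of which is a cut point, such that $M\setminus\{x,y\}$ is disconnected; it is inseparable if $x$ and $y$ are not separated by any other cut pair. Let $\mathcal V_I$ be the set of all inseparable cut pairs of $M$. For $A,B\in\mathcal V_I$ let the interval $(A,B)$ be the set of all $C\in\mathcal V_I$ such that $C$ separates at least one point of $A$ from at least one point of $B$. A star is a maximal subset $S\subseteq\mathcal V_I$ with the property that $(A,B)=\emptyset$ for all $A,B\in S$; let $\mathcal W$ be the set of all stars. (If $\mathcal V_I=\emptyset$, the only star is the empty set.) Let $\mathcal T_M$ be the bipartite graph with vertex set $\mathcal V_I\sqcup\mathcal W$ in which $V\in\mathcal V_I$ and $W\in\mathcal W$ are joined by an edge if and only if $V\in W$. Then $\mathcal T_M$ is a simplicial tree (a nonempty connected graph without cycles). Moreover, for all $A,B\in\mathcal V_I$ the interval $(A,B)$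 is finite. -/

import Mathlib

namespace CutPairTree

variable {M : Type*} [TopologicalSpace M]

/-- `x` is a (global) cut point of the (connected) space `M`: its complement is disconnected.
The empty set counts as connected, so the point of a one-point space is not a cut point. -/
def IsCutPoint (x : M) : Prop :=
  ¬ IsPreconnected ({x}ᶜ : Set M)

/-- `S` separates `a` from `b`: both points lie outside `S`, in different components
of the complement of `S`. -/
def Separates (S : Set M) (a b : M) : Prop :=
  a ∉ S ∧ b ∉ S ∧ b ∉ connectedComponentIn Sᶜ a

/-- A cut pair: a set of two distinct points, neither of them a cut point,
whose complement is disconnected. -/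
def IsCutPair (C : Set M) : Prop :=
  ∃ x y : M, x ≠ y ∧ C = {x, y} ∧ ¬ IsCutPoint x ∧ ¬ IsCutPoint y ∧ ¬ IsPreconnected Cᶜ

/-- A cut pair is inseparable if its points are not separated by any other cut pair. -/
def IsInseparableCutPair (C : Set M) : Prop :=
  IsCutPair C ∧
    ∀ D : Set M, IsCutPair D → D ≠ C → ∀ x ∈ C, ∀ y ∈ C, ¬ Separates D x y

variable (M) in
/-- The type of all inseparable cut pairs of `M`. -/
def InsepCutPair : Type _ :=
  {C : Set M // IsInseparableCutPair C}

/-- `C` is between `A` and `B`: the set `C` separates at least one point of `A`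
from at least one point of `B`. -/
def Between (A C B : InsepCutPair M) : Prop :=
  ∃ a ∈ A.1, ∃ b ∈ B.1, Separates C.1 a b

/-- The open interval `(A, B)`: all inseparable cut pairs between `A` and `B`. -/
def openInterval (A B : InsepCutPair M) : Set (InsepCutPair M) :=
  {C | Between A C B}

/-- A star: a maximal set of inseparable cut pairs with all intervals between
its members empty. -/
def IsStar (S : Set (InsepCutPair M)) : Prop :=
  Maximal (fun T : Set (InsepCutPair M) => ∀ A ∈ T, ∀ B ∈ T, openInterval A B = ∅) S

variable (M) in
/-- The type of all stars of `M`. -/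
def StarVertex : Type _ :=
  {S : Set (InsepCutPair M) // IsStar S}

variable (M) in
/-- The bipartite graph on the disjoint union of the inseparable cut pairs and the stars,
a cut pair being joined to each star that contains it. -/
def cutPairGraph : SimpleGraph (InsepCutPair M ⊕ StarVertex M) where
  Adj
    | Sum.inl V, Sum.inr W => V ∈ W.1
    | Sum.inr W, Sum.inl V => V ∈ W.1
    | _, _ => False
  symm := ⟨by rintro (V | W) (V' | W') h <;> exact h⟩
  loopless := ⟨by rintro (V | W) h <;> exact h⟩

end CutPairTree

/-!
Betweenness makes the inseparable cut pairs into a pretree, because the component of `a` in the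
complement of a cut pair `C` has frontier exactly `C`. In a pretree with finite intervals two
points are joined through stars by induction on the size of their interval, and removing an edge
`v — S` of the star graph disconnects it, as a star through `v` is determined by the
side of `v` on which its other points lie.

Finiteness of intervals: of two pairs separating `a` from `b`, either the components of `a` or
those of `b` are nested. So an infinite interval contains a sequence of pairs `{xₙ, yₙ}` that are
the frontiers of an increasing sequence of open sets `Uₙ`. Let `xₙ → x` and `yₙ → y` along a
nonprincipal ultrafilter; local connectedness puts the frontier of `⋃ Uₙ` inside `{x, y}`. If
`x = y`, this is a cut point. If `x ≠ y`, then by compactness the layers `Uₖ \ Uᵢ` eventually lie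
in the union of two disjoint neighbourhoods of `x` and `y`, and for `i < j < k` the cut pair
`{xᵢ, xₖ}` separates `xⱼ` from `yⱼ`.
-/

namespace CutPairTree

open Set Filter Topology

section Pretree

variable {α : Type*} {I : α → α → Set α}

/-- A pretree in the sense of Bowditch, presented by its open intervals: `c ∈ I a b` says that
`c` lies strictly between `a` and `b`. -/
structure IsPretree (I : α → α → Set α) : Prop where
  interval_self (a : α) : I a a = ∅
  interval_comm (a b : α) : I a b = I b a
  left_notMem (a b : α) : a ∉ I a b
  mem_or_mem {a b c : α} (hc : c ∈ I a b) {d : α} (hd : d ≠ c) : c ∈ I a d ∨ c ∈ I d b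
  notMem_of_mem {a b c : α} (hc : c ∈ I a b) : b ∉ I a c

/-- The set `T` has only empty intervals between its points; stars are the maximal such sets. -/
def IntervalFree (I : α → α → Set α) (T : Set α) : Prop :=
  ∀ a ∈ T, ∀ b ∈ T, I a b = ∅

/-- The type of stars of an interval function. -/
def PretreeStar (I : α → α → Set α) : Type _ :=
  {S : Set α // Maximal (IntervalFree I) S}

/-- The bipartite graph on points and stars, a point being joined to each star containing it.
For the inseparable cut pairs of a space it is `cutPairGraph`. -/
def starGraph (I : α → α → Set α) : SimpleGraph (α ⊕ PretreeStar I) where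
  Adj
    | Sum.inl a, Sum.inr S => a ∈ S.1
    | Sum.inr S, Sum.inl a => a ∈ S.1
    | _, _ => False
  symm := ⟨by rintro (a | S) (b | T) h <;> exact h⟩
  loopless := ⟨by rintro (a | S) h <;> exact h⟩

theorem IntervalFree.exists_subset_star {T : Set α} (hT : IntervalFree I T) :
    ∃ S : PretreeStar I, T ⊆ S.1 := by
  obtain ⟨S, hTS, hS⟩ := zorn_subset_nonempty {T | IntervalFree I T} (fun c hc hchain _ => by
    refine ⟨⋃₀ c, ?_, fun _ => subset_sUnion_of_mem⟩
    rintro a ⟨s, hs, has⟩ b ⟨t, ht, hbt⟩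
    rcases hchain.total hs ht with hst | hts
    · exact hc ht a (hst has) b hbt
    · exact hc hs a has b (hts hbt)) T hT
  exact ⟨⟨S, hS⟩, hTS⟩

namespace IsPretree

theorem right_notMem (hI : IsPretree I) (a b : α) : b ∉ I a b :=
  hI.interval_comm b a ▸ hI.left_notMem b a

theorem interval_ssubset (hI : IsPretree I) {a b c : α} (hc : c ∈ I a b) : I a c ⊂ I a b := by
  refine (ssubset_iff_of_subset fun d hd => ?_).2 ⟨c, hc, hI.right_notMem a c⟩
  have hdb : d ≠ b := by
    rintro rfl
    exact hI.notMem_of_mem hc hd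
  have hdc : d ≠ c := by
    rintro rfl
    exact hI.right_notMem a d hd
  refine (hI.mem_or_mem hd hdb.symm).resolve_right fun hdbc => ?_
  rcases hI.mem_or_mem hc hdc with hcad | hcdb
  · exact hI.notMem_of_mem hd hcad
  · rw [hI.interval_comm] at hcdb
    exact hI.notMem_of_mem hdbc hcdb

theorem intervalFree_singleton (hI : IsPretree I) (a : α) : IntervalFree I {a} := by
  rintro _ rfl _ rfl
  exact hI.interval_self _

theorem intervalFree_pair (hI : IsPretree I) {a b : α} (hab : I a b = ∅) :
    IntervalFree I {a, b} := by
  rintro _ (rfl | rfl) _ (rfl | rfl)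
  · exact hI.interval_self _
  · exact hab
  · exact hI.interval_comm _ _ ▸ hab
  · exact hI.interval_self _

theorem star_nonempty [Nonempty α] (hI : IsPretree I) (S : PretreeStar I) : S.1.Nonempty := by
  obtain ⟨a⟩ := ‹Nonempty α›
  by_contra hS
  rw [not_nonempty_iff_eq_empty] at hS
  have ha : {a} ⊆ S.1 := S.2.le_of_ge (hI.intervalFree_singleton a) (hS.le.trans bot_le)
  exact hS.le (ha rfl)

theorem starGraph_reachable_of_mem {S : PretreeStar I} {a : α} (ha : a ∈ S.1) :
    (starGraph I).Reachable (Sum.inl a) (Sum.inr S) :=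
  SimpleGraph.Adj.reachable (G := starGraph I) ha

theorem starGraph_reachable_inl (hI : IsPretree I) (hfin : ∀ a b, (I a b).Finite) (a b : α) :
    (starGraph I).Reachable (Sum.inl a) (Sum.inl b) := by
  induction hn : (I a b).ncard using Nat.strong_induction_on generalizing a b with
  | _ n ih =>
    rcases (I a b).eq_empty_or_nonempty with hab | ⟨c, hc⟩
    · obtain ⟨S, hS⟩ := (hI.intervalFree_pair hab).exists_subset_star
      exact (starGraph_reachable_of_mem (hS (Or.inl rfl))).trans
        (starGraph_reachable_of_mem (hS (Or.inr rfl))).symm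
    · have hac : (I a c).ncard < n := hn ▸ ncard_lt_ncard (hI.interval_ssubset hc) (hfin a b)
      have hcb : (I c b).ncard < n := by
        rw [hI.interval_comm c b, ← hn, hI.interval_comm a b]
        exact ncard_lt_ncard (hI.interval_ssubset (hI.interval_comm a b ▸ hc)) (hfin b a)
      exact (ih _ hac a c rfl).trans (ih _ hcb c b rfl)

theorem starGraph_connected (hI : IsPretree I) (hfin : ∀ a b, (I a b).Finite) :
    (starGraph I).Connected := by
  obtain ⟨S₀, -⟩ := IntervalFree.exists_subset_star (I := I) (T := ∅) (by simp [IntervalFree])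
  have : Nonempty (α ⊕ PretreeStar I) := ⟨Sum.inr S₀⟩
  refine SimpleGraph.Connected.mk fun v w => ?_
  rcases isEmpty_or_nonempty α with hα | ⟨⟨a⟩⟩
  · rcases v with b | S
    · exact hα.elim b
    rcases w with b | T
    · exact hα.elim b
    rw [show S = T from Subtype.ext (Subsingleton.elim _ _)]
  · have hreach : ∀ u, (starGraph I).Reachable (Sum.inl a) u := by
      rintro (b | S)
      · exact hI.starGraph_reachable_inl hfin a b
      · have : Nonempty α := ⟨a⟩
        obtain ⟨b, hb⟩ := hI.star_nonempty S
        exact (hI.starGraph_reachable_inl hfin a b).trans (starGraph_reachable_of_mem hb)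
    exact (hreach v).symm.trans (hreach w)

/-- The points on the same side of `v` as some point of `S` other than `v`. -/
def branch (I : α → α → Set α) (v : α) (S : Set α) : Set α :=
  {a | a ≠ v ∧ ∃ x ∈ S, x ≠ v ∧ v ∉ I a x}

theorem mem_branch_of_mem (hI : IsPretree I) {v a : α} {S : Set α} (ha : a ∈ S) (hav : a ≠ v) :
    a ∈ branch I v S :=
  ⟨hav, a, ha, hav, by simp only [hI.interval_self, mem_empty_iff_false, not_false_iff]⟩

theorem mem_branch_of_notMem_interval (hI : IsPretree I) {v a b : α} {S : Set α}
    (hb : b ∈ branch I v S) (hav : a ≠ v) (hab : v ∉ I a b) : a ∈ branch I v S := by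
  obtain ⟨hbv, x, hx, hxv, hbx⟩ := hb
  exact ⟨hav, x, hx, hxv, fun hax => (hI.mem_or_mem hax hbv).elim hab hbx⟩

theorem notMem_interval_of_mem_star (S : PretreeStar I) {a b : α} (ha : a ∈ S.1) (hb : b ∈ S.1)
    (c : α) : c ∉ I a b :=
  eq_empty_iff_forall_notMem.1 (S.2.prop a ha b hb) c

theorem interval_eq_empty_of_mem_branch (hI : IsPretree I) {S T : PretreeStar I} {v y : α}
    (hvS : v ∈ S.1) (hvT : v ∈ T.1) (hyT : y ∈ T.1) (hy : y ∈ branch I v S.1) {a b : α}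
    (ha : a ∈ S.1) (hb : b ∈ T.1) : I a b = ∅ := by
  obtain ⟨hyv, x, hxS, hxv, hyx⟩ := hy
  rw [hI.interval_comm] at hyx
  refine eq_empty_of_forall_notMem fun c hc => ?_
  rcases eq_or_ne c v with rfl | hcv
  · rcases hI.mem_or_mem hc hxv with hcax | hcxb
    · exact notMem_interval_of_mem_star S ha hxS c hcax
    · exact (hI.mem_or_mem hcxb hyv).elim hyx (notMem_interval_of_mem_star T hyT hb c)
  · exact (hI.mem_or_mem hc hcv.symm).elim (notMem_interval_of_mem_star S ha hvS c)
      (notMem_interval_of_mem_star T hvT hb c)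

theorem star_eq_of_mem_branch (hI : IsPretree I) {S T : PretreeStar I} {v y : α}
    (hvS : v ∈ S.1) (hvT : v ∈ T.1) (hyT : y ∈ T.1) (hy : y ∈ branch I v S.1) : T = S := by
  have hST : ∀ a ∈ S.1, ∀ b ∈ T.1, I a b = ∅ := fun a ha b hb =>
    hI.interval_eq_empty_of_mem_branch hvS hvT hyT hy ha hb
  have hfree : IntervalFree I (S.1 ∪ T.1) := by
    rintro a (ha | ha) b (hb | hb)
    · exact S.2.prop a ha b hb
    · exact hST a ha b hb
    · exact hI.interval_comm a b ▸ hST b hb a ha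
    · exact T.2.prop a ha b hb
  exact Subtype.ext ((T.2.eq_of_subset hfree subset_union_right).trans
    (S.2.eq_of_subset hfree subset_union_left).symm)

/-- The side of the edge `v — S` of the star graph that contains `S`: the points of the branch at
`v` through `S`, the stars meeting this branch, and `S` itself, which misses the branch when
`S = {v}`. -/
def starSide (I : α → α → Set α) (v : α) (S : PretreeStar I) : Set (α ⊕ PretreeStar I) :=
  {p | Sum.elim (· ∈ branch I v S.1) (fun T => T = S ∨ (T.1 ∩ branch I v S.1).Nonempty) p}

theorem inl_mem_starSide_iff_inr_mem (hI : IsPretree I) {S T : PretreeStar I} {v a : α}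
    (hv : v ∈ S.1) (ha : a ∈ T.1) (hne : ¬ (a = v ∧ T = S)) :
    Sum.inl a ∈ starSide I v S ↔ Sum.inr T ∈ starSide I v S := by
  constructor
  · exact fun h => Or.inr ⟨a, ha, h⟩
  · rintro (rfl | ⟨y, hyT, hy⟩)
    · exact hI.mem_branch_of_mem ha fun hav => hne ⟨hav, rfl⟩
    · have hav : a ≠ v := by
        rintro rfl
        exact hne ⟨rfl, hI.star_eq_of_mem_branch hv ha hyT hy⟩
      exact hI.mem_branch_of_notMem_interval hy hav (notMem_interval_of_mem_star T ha hyT v)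

theorem starGraph_isBridge (hI : IsPretree I) {v : α} {S : PretreeStar I} (hv : v ∈ S.1) :
    (starGraph I).IsBridge s(Sum.inl v, Sum.inr S) := by
  rw [SimpleGraph.isBridge_iff]
  have hadj : ∀ p q, ((starGraph I).deleteEdges {s(Sum.inl v, Sum.inr S)}).Adj p q →
      (p ∈ starSide I v S ↔ q ∈ starSide I v S) := by
    intro p q h
    obtain ⟨hpq, hne⟩ := SimpleGraph.deleteEdges_adj.1 h
    rcases p with a | T <;> rcases q with b | T'
    · exact hpq.elim
    · refine hI.inl_mem_starSide_iff_inr_mem hv hpq ?_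
      rintro ⟨rfl, rfl⟩
      exact hne rfl
    · refine (hI.inl_mem_starSide_iff_inr_mem hv hpq ?_).symm
      rintro ⟨rfl, rfl⟩
      exact hne Sym2.eq_swap
    · exact hpq.elim
  have hwalk : ∀ {p q} (_ : ((starGraph I).deleteEdges {s(Sum.inl v, Sum.inr S)}).Walk p q),
      (p ∈ starSide I v S ↔ q ∈ starSide I v S) := by
    intro p q w
    induction w with
    | nil => rfl
    | cons h _ ih => exact (hadj _ _ h).trans ih
  have hvS : Sum.inl v ∉ starSide I v S := fun h => h.1 rfl
  exact fun ⟨w⟩ => hvS ((hwalk w).2 (Or.inl rfl))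

theorem starGraph_isAcyclic (hI : IsPretree I) : (starGraph I).IsAcyclic := by
  rw [SimpleGraph.isAcyclic_iff_forall_adj_isBridge]
  rintro (a | S) (b | T) h
  · exact h.elim
  · exact hI.starGraph_isBridge h
  · rw [Sym2.eq_swap]
    exact hI.starGraph_isBridge h
  · exact h.elim

theorem starGraph_isTree (hI : IsPretree I) (hfin : ∀ a b, (I a b).Finite) :
    (starGraph I).IsTree :=
  ⟨hI.starGraph_connected hfin, hI.starGraph_isAcyclic⟩

end IsPretree

end Pretree

section Frontier

variable {X : Type*} [TopologicalSpace X]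

theorem subset_or_disjoint_of_disjoint_frontier {T U : Set X} (hT : IsPreconnected T)
    (hTU : Disjoint T (frontier U)) : T ⊆ U ∨ Disjoint T U := by
  have hcover : T ⊆ interior U ∪ interior Uᶜ := by
    rw [← compl_frontier_eq_union_interior]
    exact hTU.subset_compl_right
  rcases isPreconnected_iff_subset_of_disjoint.1 hT _ _ isOpen_interior isOpen_interior hcover
    (by rw [(disjoint_compl_right.mono interior_subset interior_subset).inter_eq, inter_empty])
    with h | h
  · exact Or.inl (h.trans interior_subset)
  · exact Or.inr (subset_compl_iff_disjoint_right.1 (h.trans interior_subset))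

theorem frontier_sdiff_closure_subset (U V : Set X) :
    frontier (U \ closure V) ⊆ frontier U ∪ frontier V := by
  refine (frontier_inter_subset U (closure V)ᶜ).trans
    (union_subset_union inter_subset_left (inter_subset_right.trans ?_))
  rw [frontier_compl]
  exact frontier_closure_subset

theorem frontier_inter_subset_frontier_sdiff {P Q V : Set X} (hP : IsOpen P) (hQ : IsOpen Q)
    (hPQ : Disjoint P Q) (hV : V ⊆ P ∪ Q) : frontier (P ∩ V) ⊆ frontier V \ Q := by
  intro w hw
  have hwcl := frontier_subset_closure hw
  have hwQ : w ∉ Q := disjoint_left.1 ((hPQ.mono_left inter_subset_left).closure_left hQ) hwcl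
  refine ⟨⟨closure_mono inter_subset_right hwcl, fun hwV => hw.2 ?_⟩, hwQ⟩
  have hwP : w ∈ P := (hV (interior_subset hwV)).resolve_right hwQ
  rw [interior_inter, hP.interior_eq]
  exact ⟨hwP, hwV⟩

theorem frontier_connectedComponentIn_subset_compl [LocallyConnectedSpace X] {F : Set X}
    (hF : IsOpen F) (a : X) : frontier (connectedComponentIn F a) ⊆ Fᶜ := by
  intro z hz hzF
  rw [hF.connectedComponentIn.frontier_eq] at hz
  obtain ⟨w, hwz, hwa⟩ := mem_closure_iff.1 hz.1 _ (hF.connectedComponentIn (x := z))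
    (mem_connectedComponentIn hzF)
  rw [connectedComponentIn_eq hwa, ← connectedComponentIn_eq hwz] at hz
  exact hz.2 (mem_connectedComponentIn hzF)

theorem eventually_inter_frontier_nonempty [LocallyConnectedSpace X] {ι : Type*} [Preorder ι]
    {U : ι → Set X} (hU : Monotone U) {z : X} (hz : z ∈ frontier (⋃ i, U i)) {F : Set X}
    (hF : F ∈ 𝓝 z) : ∀ᶠ i in atTop, (F ∩ frontier (U i)).Nonempty := by
  obtain ⟨O, hOF, hO, hzO, hOc⟩ :=
    locallyConnectedSpace_iff_subsets_isOpen_isConnected.1 ‹_› z F hF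
  obtain ⟨w, hwO, hw⟩ := mem_closure_iff.1 (frontier_subset_closure hz) O hO hzO
  obtain ⟨j, hwj⟩ := mem_iUnion.1 hw
  filter_upwards [eventually_ge_atTop j] with i hi
  by_contra hdisj
  rw [← not_disjoint_iff_nonempty_inter, not_not] at hdisj
  rcases subset_or_disjoint_of_disjoint_frontier hOc.isPreconnected (hdisj.mono_left hOF)
    with hOU | hOU
  · exact hz.2 (mem_interior.2 ⟨O, hOU.trans (subset_iUnion U i), hO, hzO⟩)
  · exact disjoint_left.1 hOU hwO (hU hi hwj)

theorem frontier_iUnion_subset_pair [LocallyConnectedSpace X] [T2Space X] {ι : Type*} [Preorder ι]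
    {U : ι → Set X} (hU : Monotone U) {L : Filter ι} [L.NeBot] (hL : L ≤ atTop) {x y : ι → X}
    {x₀ y₀ : X} (hfr : ∀ i, frontier (U i) = {x i, y i}) (hx : Tendsto x L (𝓝 x₀))
    (hy : Tendsto y L (𝓝 y₀)) : frontier (⋃ i, U i) ⊆ {x₀, y₀} := by
  intro z hz
  by_contra hzxy
  rw [mem_insert_iff, mem_singleton_iff, not_or] at hzxy
  obtain ⟨F, hF, P, hP, hFP⟩ := Filter.disjoint_iff.1 (disjoint_nhds_nhds.2 hzxy.1)
  obtain ⟨G, hG, Q, hQ, hGQ⟩ := Filter.disjoint_iff.1 (disjoint_nhds_nhds.2 hzxy.2)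
  obtain ⟨i, ⟨w, ⟨hwF, hwG⟩, hwi⟩, hxP, hyQ⟩ :=
    (((eventually_inter_frontier_nonempty hU hz (inter_mem hF hG)).filter_mono hL).and
      ((hx.eventually_mem hP).and (hy.eventually_mem hQ))).exists
  rw [hfr] at hwi
  rcases hwi with rfl | rfl
  · exact disjoint_left.1 hFP hwF hxP
  · exact disjoint_left.1 hGQ hwG hyQ

theorem exists_inter_iUnion_subset {ι : Type*} [Nonempty ι] {U : ι → Set X}
    (hopen : ∀ i, IsOpen (U i)) (hU : Directed (· ⊆ ·) U) {K : Set X} (hK : IsCompact K)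
    (hfr : Disjoint K (frontier (⋃ i, U i))) : ∃ n, K ∩ ⋃ i, U i ⊆ U n := by
  have hclosure : K ∩ ⋃ i, U i = K ∩ closure (⋃ i, U i) := by
    rw [closure_eq_self_union_frontier, inter_union_distrib_left, hfr.inter_eq, union_empty]
  refine IsCompact.elim_directed_cover ?_ U hopen inter_subset_right hU
  rw [hclosure]
  exact hK.inter_right isClosed_closure

end Frontier

section Separation

variable {M : Type*} [TopologicalSpace M]

theorem Separates.symm {S : Set M} {a b : M} (h : Separates S a b) : Separates S b a := by
  refine ⟨h.2.1, h.1, fun hab => h.2.2 ?_⟩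
  rw [← connectedComponentIn_eq hab]
  exact mem_connectedComponentIn h.2.1

theorem Separates.or_of_notMem {S : Set M} {a b c : M} (h : Separates S a b) (hc : c ∉ S) :
    Separates S a c ∨ Separates S c b := by
  refine or_iff_not_imp_left.2 fun hac => ⟨hc, h.2.1, fun hbc => h.2.2 ?_⟩
  have hca : c ∈ connectedComponentIn Sᶜ a := not_not.1 fun hca => hac ⟨h.1, hc, hca⟩
  rwa [connectedComponentIn_eq hca]

theorem Separates.not_isPreconnected {S T : Set M} {a b : M} (h : Separates S a b)
    (hTS : Disjoint T S) (ha : a ∈ T) (hb : b ∈ T) : ¬ IsPreconnected T :=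
  fun hT => h.2.2 (hT.subset_connectedComponentIn ha hTS.subset_compl_right hb)

theorem separates_of_frontier_subset {S W : Set M} {a b : M} (hW : frontier W ⊆ S) (haS : a ∉ S)
    (hbS : b ∉ S) (haW : a ∈ W) (hbW : b ∉ W) : Separates S a b := by
  refine ⟨haS, hbS, fun hb => ?_⟩
  have hdisj : Disjoint (connectedComponentIn Sᶜ a) (frontier W) :=
    disjoint_left.2 fun w hw hwW => connectedComponentIn_subset _ _ hw (hW hwW)
  rcases subset_or_disjoint_of_disjoint_frontier isPreconnected_connectedComponentIn hdisj
    with hsub | hsub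
  · exact hbW (hsub hb)
  · exact disjoint_left.1 hsub (mem_connectedComponentIn haS) haW

theorem connectedComponentIn_compl_subset {C D : Set M} {a : M} (ha : a ∉ C)
    (hD : Disjoint (connectedComponentIn Cᶜ a) D) :
    connectedComponentIn Cᶜ a ⊆ connectedComponentIn Dᶜ a :=
  isPreconnected_connectedComponentIn.subset_connectedComponentIn (mem_connectedComponentIn ha)
    hD.subset_compl_right

theorem IsCutPair.finite {C : Set M} (hC : IsCutPair C) : C.Finite := by
  obtain ⟨x, y, -, rfl, -⟩ := hC
  exact toFinite _

theorem IsCutPair.ncard {C : Set M} (hC : IsCutPair C) : C.ncard = 2 := by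
  obtain ⟨x, y, hxy, rfl, -⟩ := hC
  exact ncard_pair hxy

theorem IsCutPair.nontrivial {C : Set M} (hC : IsCutPair C) : C.Nontrivial := by
  obtain ⟨x, y, hxy, rfl, -⟩ := hC
  exact nontrivial_pair hxy

theorem IsCutPair.exists_mem_notMem {C D : Set M} (hC : IsCutPair C) (hD : IsCutPair D)
    (hne : D ≠ C) : ∃ d ∈ D, d ∉ C :=
  not_subset.1 fun hDC => hne (eq_of_subset_of_ncard_le hDC (by rw [hC.ncard, hD.ncard]) hC.finite)

theorem IsInseparableCutPair.not_separates {C D : Set M} (hC : IsInseparableCutPair C)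
    (hD : IsCutPair D) {x y : M} (hx : x ∈ C) (hy : y ∈ C) : ¬ Separates D x y := by
  intro h
  exact hC.2 D hD (fun hDC => h.1 (hDC ▸ hx)) x hx y hy h

theorem IsInseparableCutPair.disjoint_component {B C : Set M} (hB : IsInseparableCutPair B)
    (hC : IsCutPair C) {a b : M} (hb : b ∈ B) (h : Separates C a b) :
    Disjoint (connectedComponentIn Cᶜ a) B := by
  refine disjoint_left.2 fun w hw hwB => ?_
  rcases h.or_of_notMem (connectedComponentIn_subset _ _ hw) with haw | hwb
  · exact haw.2.2 hw
  · exact hB.not_separates hC hwB hb hwb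

theorem IsCutPair.isOpen_component [T1Space M] [LocallyConnectedSpace M] {C : Set M}
    (hC : IsCutPair C) (a : M) : IsOpen (connectedComponentIn Cᶜ a) :=
  hC.finite.isClosed.isOpen_compl.connectedComponentIn

theorem IsCutPair.frontier_component [T1Space M] [LocallyConnectedSpace M] {C : Set M}
    (hC : IsCutPair C) {a : M} (ha : a ∉ C) : frontier (connectedComponentIn Cᶜ a) = C := by
  have hsub : frontier (connectedComponentIn Cᶜ a) ⊆ C := by
    simpa only [compl_compl] using
      frontier_connectedComponentIn_subset_compl hC.finite.isClosed.isOpen_compl a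
  have hmem : ∀ x y : M, x ≠ y → C = {x, y} → ¬ IsCutPoint y →
      x ∈ frontier (connectedComponentIn Cᶜ a) := by
    rintro x y hxy rfl hy
    by_contra hx
    have hfr : Disjoint {y}ᶜ (frontier (connectedComponentIn {x, y}ᶜ a)) :=
      disjoint_left.2 fun w hwy hw => (hsub hw).elim (fun hwx => hx (hwx ▸ hw)) hwy
    rcases subset_or_disjoint_of_disjoint_frontier (not_not.1 hy) hfr with h | h
    · exact connectedComponentIn_subset _ _ (h hxy) (Or.inl rfl)
    · exact disjoint_left.1 h (fun hay => ha (Or.inr hay)) (mem_connectedComponentIn ha)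
  refine hsub.antisymm ?_
  obtain ⟨x, y, hxy, hCxy, hx, hy, -⟩ := hC
  rw [hCxy, insert_subset_iff, singleton_subset_iff, ← hCxy]
  exact ⟨hmem x y hxy hCxy hy, hmem y x hxy.symm (hCxy.trans (pair_comm x y)) hx⟩

end Separation

section Betweenness

variable {M : Type*} [TopologicalSpace M]

theorem Between.symm {A B C : InsepCutPair M} (h : Between A C B) : Between B C A := by
  obtain ⟨a, ha, b, hb, hab⟩ := h
  exact ⟨b, hb, a, ha, hab.symm⟩

theorem Between.left_or_right {A B C D : InsepCutPair M} (h : Between A C B) (hD : D ≠ C) :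
    Between A C D ∨ Between D C B := by
  obtain ⟨a, ha, b, hb, hab⟩ := h
  obtain ⟨d, hd, hdC⟩ := C.2.1.exists_mem_notMem D.2.1 (Subtype.val_injective.ne hD)
  exact (hab.or_of_notMem hdC).imp (fun had => ⟨a, ha, d, hd, had⟩) fun hdb => ⟨d, hd, b, hb, hdb⟩

theorem Between.asymm [T1Space M] [LocallyConnectedSpace M] {A B C : InsepCutPair M}
    (h : Between A C B) : ¬ Between A B C := by
  rintro ⟨a', ha', c, hc, hB⟩
  obtain ⟨a, ha, b, hb, hC⟩ := h
  have ha'C : a' ∉ C.1 := fun h => C.2.not_separates B.2.1 h hc hB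
  have ha'U : a' ∈ connectedComponentIn C.1ᶜ a :=
    not_not.1 fun h => A.2.not_separates C.2.1 ha ha' ⟨hC.1, ha'C, h⟩
  have hcU : c ∈ closure (connectedComponentIn C.1ᶜ a) :=
    frontier_subset_closure ((C.2.1.frontier_component hC.1).ge hc)
  have hdisj : Disjoint (insert c (connectedComponentIn C.1ᶜ a)) B.1 :=
    disjoint_insert_left.2 ⟨hB.2.1, B.2.disjoint_component C.2.1 hb hC⟩
  exact hB.not_isPreconnected hdisj (Or.inr ha'U) (Or.inl rfl)
    (isPreconnected_connectedComponentIn.subset_closure (subset_insert _ _)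
      (insert_subset hcU subset_closure))

theorem isPretree_openInterval [T1Space M] [LocallyConnectedSpace M] :
    IsPretree (openInterval (M := M)) where
  interval_self A := eq_empty_of_forall_notMem fun C ⟨_, ha, _, hb, hab⟩ =>
    A.2.not_separates C.2.1 ha hb hab
  interval_comm _ _ := ext fun _ => ⟨Between.symm, Between.symm⟩
  left_notMem _ _ := fun ⟨_, ha, _, _, hab⟩ => hab.1 ha
  mem_or_mem hC _ hD := Between.left_or_right hC hD
  notMem_of_mem hC := Between.asymm hC

theorem cutPairGraph_eq_starGraph : cutPairGraph M = starGraph openInterval := by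
  ext (A | S) (B | T) <;> rfl

end Betweenness

section FiniteIntervals

variable {M : Type*} [TopologicalSpace M]

theorem component_subset_or_component_subset {C D : Set M} (hC : IsCutPair C)
    (hD : IsInseparableCutPair D) {a b : M} (hab : Separates C a b) :
    connectedComponentIn Cᶜ a ⊆ connectedComponentIn Dᶜ a ∨
      connectedComponentIn Cᶜ b ⊆ connectedComponentIn Dᶜ b := by
  by_cases hdisj : Disjoint (connectedComponentIn Cᶜ a) D
  · exact Or.inl (connectedComponentIn_compl_subset hab.1 hdisj)
  · obtain ⟨d, hda, hd⟩ := not_disjoint_iff.1 hdisj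
    have hdb : Separates C d b :=
      (hab.or_of_notMem (connectedComponentIn_subset _ _ hda)).resolve_left fun h => h.2.2 hda
    exact Or.inr (connectedComponentIn_compl_subset hab.2.1
      (hD.disjoint_component hC hd hdb.symm))

theorem separates_of_nested {P Q U₁ U₂ U₃ : Set M} {x₁ x₂ x₃ y₁ y₂ y₃ : M}
    (hP : IsOpen P) (hQ : IsOpen Q) (hPQ : Disjoint P Q) (hU₂ : IsOpen U₂) (h₁₂ : U₁ ⊆ U₂)
    (h₂₃ : U₂ ⊆ U₃) (hlayer : U₃ \ U₁ ⊆ P ∪ Q) (hfr₁ : frontier U₁ = {x₁, y₁})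
    (hfr₂ : frontier U₂ = {x₂, y₂}) (hfr₃ : frontier U₃ = {x₃, y₃}) (hx₁ : x₁ ∈ P) (hx₂ : x₂ ∈ P)
    (hx₃ : x₃ ∈ P) (hy₁ : y₁ ∈ Q) (hy₂ : y₂ ∈ Q) (hy₃ : y₃ ∈ Q) (hx₂₁ : x₂ ≠ x₁)
    (hx₂₃ : x₂ ≠ x₃) : Separates {x₁, x₃} x₂ y₂ := by
  have hx₂U₂ : x₂ ∈ frontier U₂ := hfr₂ ▸ Or.inl rfl
  have hx₂U₃ : x₂ ∈ U₃ := by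
    have hx₂cl := closure_mono h₂₃ (frontier_subset_closure hx₂U₂)
    rw [closure_eq_self_union_frontier, hfr₃] at hx₂cl
    exact hx₂cl.resolve_right fun h => h.elim hx₂₃ (hPQ.ne_of_mem hx₂ hy₃)
  have hx₂U₁ : x₂ ∉ closure U₁ := by
    rw [closure_eq_self_union_frontier, hfr₁]
    rintro (h | h | h)
    · exact disjoint_left.1 (disjoint_frontier_iff_isOpen.2 hU₂) hx₂U₂ (h₁₂ h)
    · exact hx₂₁ h
    · exact hPQ.ne_of_mem hx₂ hy₁ h
  have hfr : frontier (P ∩ (U₃ \ closure U₁)) ⊆ {x₁, x₃} := by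
    intro w hw
    have hV : U₃ \ closure U₁ ⊆ P ∪ Q := (sdiff_subset_sdiff_right subset_closure).trans hlayer
    obtain ⟨hwfr, hwQ⟩ := frontier_inter_subset_frontier_sdiff hP hQ hPQ hV hw
    have hwxy := frontier_sdiff_closure_subset _ _ hwfr
    rw [hfr₁, hfr₃] at hwxy
    rcases hwxy with (rfl | rfl) | (rfl | rfl)
    · exact Or.inr rfl
    · exact absurd hy₃ hwQ
    · exact Or.inl rfl
    · exact absurd hy₁ hwQ
  exact separates_of_frontier_subset hfr (fun h => h.elim hx₂₁ hx₂₃)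
    (fun h => h.elim (hPQ.ne_of_mem hx₁ hy₂).symm (hPQ.ne_of_mem hx₃ hy₂).symm)
    ⟨hx₂, hx₂U₃, hx₂U₁⟩ fun h => hPQ.ne_of_mem h.1 hy₂ rfl

theorem not_frontier_subset_singleton {x : M} (hx : ¬ IsCutPoint x) {V : Set M}
    (hV : V.Nontrivial) (hVc : Vᶜ.Nontrivial) : ¬ frontier V ⊆ {x} := by
  intro hfr
  rcases subset_or_disjoint_of_disjoint_frontier (not_not.1 hx)
    (disjoint_compl_left_iff_subset.2 hfr) with hsub | hdisj
  · obtain ⟨p, hp, hpx⟩ := hVc.exists_ne x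
    exact hp (hsub hpx)
  · obtain ⟨p, hp, hpx⟩ := hV.exists_ne x
    exact disjoint_left.1 hdisj hpx hp

theorem exists_separates_of_tendsto [LocallyConnectedSpace M] [CompactSpace M] [T2Space M]
    {ι : Type*} [Preorder ι] [IsDirectedOrder ι] {U : ι → Set M} (hopen : ∀ i, IsOpen (U i))
    (hU : Monotone U) {x y : ι → M} (hfr : ∀ i, frontier (U i) = {x i, y i}) {L : Filter ι}
    [L.NeBot] (hL : L ≤ atTop) (hne : ∀ c, ∀ᶠ i in L, x i ≠ c) {x₀ y₀ : M}
    (hx : Tendsto x L (𝓝 x₀)) (hy : Tendsto y L (𝓝 y₀)) (hxy : x₀ ≠ y₀) :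
    ∃ i j k, x i ≠ x k ∧ Separates {x i, x k} (x j) (y j) := by
  obtain ⟨P, Q, hP, hQ, hxP, hyQ, hPQ⟩ := t2_separation hxy
  have hdisj : Disjoint (P ∪ Q)ᶜ (frontier (⋃ i, U i)) :=
    disjoint_compl_left_iff_subset.2 ((frontier_iUnion_subset_pair hU hL hfr hx hy).trans
      (pair_subset (Or.inl hxP) (Or.inr hyQ)))
  have : Nonempty ι := L.nonempty_of_neBot
  obtain ⟨n, hn⟩ := exists_inter_iUnion_subset hopen hU.directed_le
    (hP.union hQ).isClosed_compl.isCompact hdisj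
  have hlayer : ∀ i k, n ≤ i → U k \ U i ⊆ P ∪ Q := fun i k hni w hw =>
    not_not.1 fun hwPQ => hw.2 (hU hni (hn ⟨hwPQ, mem_iUnion.2 ⟨k, hw.1⟩⟩))
  have hlim : ∀ᶠ i in L, x i ∈ P ∧ y i ∈ Q :=
    (hx.eventually_mem (hP.mem_nhds hxP)).and (hy.eventually_mem (hQ.mem_nhds hyQ))
  have hge : ∀ m, ∀ᶠ i in L, m ≤ i := fun m => (eventually_ge_atTop m).filter_mono hL
  obtain ⟨i, ⟨hxi, hyi⟩, hni⟩ := (hlim.and (hge n)).exists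
  obtain ⟨j, ⟨hxj, hyj⟩, hij, hji⟩ := (hlim.and ((hge i).and (hne (x i)))).exists
  obtain ⟨k, ⟨hxk, hyk⟩, hjk, hki, hkj⟩ :=
    (hlim.and ((hge j).and ((hne (x i)).and (hne (x j))))).exists
  exact ⟨i, j, k, hki.symm, separates_of_nested hP hQ hPQ (hopen j) (hU hij) (hU hjk)
    (hlayer i k hni) (hfr i) (hfr j) (hfr k) hxi hxj hxk hyi hyj hyk hji hkj.symm⟩

theorem not_tendsto_of_isInseparableCutPair_frontier [LocallyConnectedSpace M] [CompactSpace M]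
    [T2Space M] (hM : ∀ x : M, ¬ IsCutPoint x) {ι : Type*} [Preorder ι] [IsDirectedOrder ι]
    {U : ι → Set M} (hopen : ∀ i, IsOpen (U i)) (hU : Monotone U)
    (hinsep : ∀ i, IsInseparableCutPair (frontier (U i))) {x y : ι → M}
    (hfr : ∀ i, frontier (U i) = {x i, y i}) {L : Filter ι} [L.NeBot] (hL : L ≤ atTop)
    (hne : ∀ c, ∀ᶠ i in L, x i ≠ c) {x₀ y₀ : M} (hxy : x₀ ≠ y₀) (hx : Tendsto x L (𝓝 x₀)) :
    ¬ Tendsto y L (𝓝 y₀) := by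
  intro hy
  obtain ⟨i, j, k, hik, hsep⟩ := exists_separates_of_tendsto hopen hU hfr hL hne hx hy hxy
  have hcut : IsCutPair {x i, x k} :=
    ⟨x i, x k, hik, rfl, hM _, hM _, hsep.not_isPreconnected disjoint_compl_left hsep.1 hsep.2.1⟩
  exact (hinsep j).not_separates hcut ((hfr j).ge (Or.inl rfl)) ((hfr j).ge (Or.inr rfl)) hsep

theorem eventually_ne_or_eventually_ne {ι α β : Type*} {L : Ultrafilter ι}
    (hL : (L : Filter ι) ≤ cofinite) {x : ι → α} {y : ι → β}
    (hinj : Function.Injective fun i => (x i, y i)) :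
    (∀ c, ∀ᶠ i in L, x i ≠ c) ∨ ∀ d, ∀ᶠ i in L, y i ≠ d := by
  by_contra! h
  obtain ⟨⟨c, hc⟩, d, hd⟩ := h
  have hne : ∀ᶠ i in (L : Filter ι), (x i, y i) ≠ (c, d) :=
    (hinj.tendsto_cofinite.mono_left hL).eventually (eventually_cofinite_ne (c, d))
  obtain ⟨i, hi, hci, hdi⟩ := (hne.and (hc.and hd)).exists
  exact hi (Prod.ext hci hdi)

theorem not_monotone_of_isInseparableCutPair_frontier [LocallyConnectedSpace M] [CompactSpace M]
    [T2Space M] (hM : ∀ x : M, ¬ IsCutPoint x) {U : ℕ → Set M} (hopen : ∀ n, IsOpen (U n))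
    (hinj : Function.Injective fun n => frontier (U n))
    (hinsep : ∀ n, IsInseparableCutPair (frontier (U n))) (hout : (⋃ n, U n)ᶜ.Nontrivial) :
    ¬ Monotone U := by
  intro hU
  choose x y _ hfr _ using fun n => (hinsep n).1
  have : Nonempty M := ⟨x 0⟩
  let L : Ultrafilter ℕ := hyperfilter ℕ
  have hL : (L : Filter ℕ) ≤ atTop := Nat.hyperfilter_le_atTop
  obtain ⟨x₀, hx⟩ : ∃ x₀, Tendsto x L (𝓝 x₀) := ⟨_, (L.map x).le_nhds_lim⟩
  obtain ⟨y₀, hy⟩ : ∃ y₀, Tendsto y L (𝓝 y₀) := ⟨_, (L.map y).le_nhds_lim⟩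
  have hnontriv : (⋃ n, U n).Nontrivial := by
    by_contra h
    exact (hinsep 0).1.nontrivial.not_subsingleton ((not_nontrivial_iff.1 h).closure.anti
      (frontier_subset_closure.trans (closure_mono (subset_iUnion U 0))))
  have hxy : x₀ ≠ y₀ := by
    rintro rfl
    exact not_frontier_subset_singleton (hM x₀) hnontriv hout
      (pair_eq_singleton x₀ ▸ frontier_iUnion_subset_pair hU hL hfr hx hy)
  simp only [hfr] at hinj
  rcases eventually_ne_or_eventually_ne hyperfilter_le_cofinite (x := x) (y := y)
    (.of_comp (f := fun p : M × M => ({p.1, p.2} : Set M)) hinj) with hne | hne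
  · exact not_tendsto_of_isInseparableCutPair_frontier hM hopen hU hinsep hfr hL hne hxy hx hy
  · exact not_tendsto_of_isInseparableCutPair_frontier hM hopen hU hinsep
      (fun n => (hfr n).trans (pair_comm _ _)) hL hne hxy.symm hy hx

theorem not_monotone_component [LocallyConnectedSpace M] [CompactSpace M] [T2Space M]
    (hM : ∀ x : M, ¬ IsCutPoint x) {C : ℕ → InsepCutPair M} (hC : Function.Injective C)
    {B : Set M} (hB : IsInseparableCutPair B) {a b : M} (hb : b ∈ B)
    (hab : ∀ n, Separates (C n).1 a b) :
    ¬ Monotone fun n => connectedComponentIn (C n).1ᶜ a := by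
  have hfr : ∀ n, frontier (connectedComponentIn (C n).1ᶜ a) = (C n).1 := fun n =>
    (C n).2.1.frontier_component (hab n).1
  have hout : B ⊆ (⋃ n, connectedComponentIn (C n).1ᶜ a)ᶜ :=
    subset_compl_iff_disjoint_left.2 (disjoint_iUnion_left.2 fun n =>
      hB.disjoint_component (C n).2.1 hb (hab n))
  refine not_monotone_of_isInseparableCutPair_frontier hM
    (fun n => (C n).2.1.isOpen_component a) ?_ (fun n => ?_) (hB.1.nontrivial.mono hout)
  · simp only [hfr]
    exact Subtype.val_injective.comp hC
  · exact (hfr n).symm ▸ (C n).2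

theorem finite_separating [LocallyConnectedSpace M] [CompactSpace M] [T2Space M]
    (hM : ∀ x : M, ¬ IsCutPoint x) {A B : Set M} (hA : IsInseparableCutPair A)
    (hB : IsInseparableCutPair B) {a b : M} (ha : a ∈ A) (hb : b ∈ B) :
    {C : InsepCutPair M | Separates C.1 a b}.Finite := by
  refine not_infinite.1 fun hinf => ?_
  obtain ⟨C, hC, hsep⟩ : ∃ C : ℕ → InsepCutPair M,
      Function.Injective C ∧ ∀ n, Separates (C n).1 a b :=
    ⟨_, Subtype.val_injective.comp (hinf.natEmbedding _).injective,
      fun n => (hinf.natEmbedding _ n).2⟩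
  obtain ⟨g, hg | hg⟩ := exists_increasing_or_nonincreasing_subseq (· ⊆ ·)
    fun n => connectedComponentIn (C n).1ᶜ a
  · exact not_monotone_component hM (hC.comp g.injective) hB hb (fun n => hsep (g n))
      (monotone_nat_of_le_succ fun n => hg n (n + 1) n.lt_succ_self)
  · refine not_monotone_component hM (hC.comp g.injective) hA ha (fun n => (hsep (g n)).symm)
      (monotone_nat_of_le_succ fun n => ?_)
    exact (component_subset_or_component_subset (C (g n)).2.1 (C (g (n + 1))).2
      (hsep (g n))).resolve_left (hg n (n + 1) n.lt_succ_self)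

theorem finite_openInterval [LocallyConnectedSpace M] [CompactSpace M] [T2Space M]
    (hM : ∀ x : M, ¬ IsCutPoint x) (A B : InsepCutPair M) : (openInterval A B).Finite := by
  refine (A.2.1.finite.biUnion fun a ha => B.2.1.finite.biUnion fun b hb =>
    finite_separating hM A.2 B.2 ha hb).subset ?_
  rintro C ⟨a, ha, b, hb, hab⟩
  exact mem_biUnion ha (mem_biUnion hb hab)

end FiniteIntervals

end CutPairTree

theorem mainTheorem6_general {M : Type*} [TopologicalSpace M] [CompactSpace M]
    [LocallyConnectedSpace M] [T2Space M] (hM : ∀ x : M, ¬ CutPairTree.IsCutPoint x) :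
    (CutPairTree.cutPairGraph M).IsTree ∧
      ∀ A B : CutPairTree.InsepCutPair M, (CutPairTree.openInterval A B).Finite := by
  have hfin := CutPairTree.finite_openInterval hM
  rw [CutPairTree.cutPairGraph_eq_starGraph]
  exact ⟨CutPairTree.isPretree_openInterval.starGraph_isTree hfin, hfin⟩

theorem mainTheorem6 {M : Type*} [TopologicalSpace M] [CompactSpace M] [ConnectedSpace M]
    [LocallyConnectedSpace M] [TopologicalSpace.MetrizableSpace M]
    (hM : ∀ x : M, ¬ CutPairTree.IsCutPoint x) :
    (CutPairTree.cutPairGraph M).IsTree ∧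
      ∀ A B : CutPairTree.InsepCutPair M, (CutPairTree.openInterval A B).Finite := by
  exact mainTheorem6_general hM
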